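/- **Setting.** Let $G$ be a (finite-dimensional, Hausdorff, second countable) real Lie group, and let $N,H\subset G$ be closed Lie subgroups such that $N$ is normal, $H$ is connected, $G=NH$ and $N\cap H=\{e\}$. Assume that $N$ is an exponential solvable Lie group: its Lie algebra $\mathfrak n$ is solvable and $\exp:\mathfrak n\to N$ is a diffeomorphism, with inverse $\log$. For $s\in G$ let $Ad(s):\mathfrak n\to\mathfrak n$ be the differential at $e$ of $y\mapsto sys^{-1}$. Let $\lambda\in\mathfrak n^*$ vanish on $[\mathfrak n,\mathfrak n]$ and let $\beta_\lambda(h)=Ad(h^{-1})^*\lambda\in\mathfrak n^*$ for $h\in H$. Let $\mu_H$ be a left Haar measure on $H$, let $\mathfrak H=L^2(H,\mu_H)$, and let $\pi=\mathrm{ind}_N^{NH}\chi_\lambda$ be the unitary representation of $G$ on $\mathfrak H$ determined by $$[\pi(x)g](h)=e^{2\pi i\langle\beta_\lambda(h),\log x\rangle}g(h)\quad(x\in N),\qquad [\pi(z)g](h)=g(z^{-1}h)\quad(z\in H).$$ Let $X_1,\dots,X_n$ be a basis of $\mathfrak n$ with dual basis $X_1^*,\dots,X_n^*$, let $J\subseteq\{1,\dots,n\}$,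 let $P$ be the projection of $\mathfrak n$ with $PX_k=X_k$ for $k\in J$ and $PX_k=0$ for $k\notin J$, and put $\mathfrak p=P\mathfrak n$ and $\mathfrak p^*=P^*\mathfrak n^*$, the latter identified with $\mathbb R^J$ through the basis $(X_j^*)_{j\in J}$ and given Lebesgue measure $d\xi$ (written $|\cdot|$). Let $(\mathcal O,\varphi)$ be a smooth chart of $H$ with $\mathcal O$ an open neighbourhood of $e$, with values in the Lie algebra $\mathfrak h$ of $H$ and with $\varphi(e)=0$, such that $\Theta_\lambda=P^*\beta_\lambda\varphi^{-1}$ is a diffeomorphism of $\varphi(\mathcal O)$ onto an open subset of $\mathfrak p^*$. Let $\mathbf W_\lambda$ be the Radon–Nikodym derivative with respect to $d\xi$ of the image under $\Theta_\lambda\circ\varphi$ of $\mu_H$ restricted to $\mathcal O$, and let $\mathbf w(h)=\mathbf W_\lambda(\Theta_\lambda(\varphi(h)))$ for $h\in\mathcal O$. **Lemma.** Let $\mathbf f:H\to\mathbb C$ be continuous and compactly supported, and zero outside $\mathcal O$. Let $\Gamma_H\subset H$ be a discrete subset such that (with the terms with $\ell h\notin\mathcal O$ read as $0$) $$0<m:=\operatorname*{ess\,inf}_{h\in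 H}\sum_{\ell\in\Gamma_H}|\mathbf f(\ell h)|^2\mathbf w(\ell h)\ \le\ M:=\operatorname*{ess\,sup}_{h\in H}\sum_{\ell\in\Gamma_H}|\mathbf f(\ell h)|^2\mathbf w(\ell h)<\infty .$$ Let $C\subset\mathfrak p^*$ be a measurable set of finite Lebesgue measure (for instance a compact set) with $\Theta_\lambda(\varphi(\mathcal O))\subseteq C$, and let $\Gamma_N\subset\exp(\mathfrak p)$ be a discrete subset such that the functions $\xi\mapsto|C|^{-1/2}e^{2\pi i\langle\xi,Y\rangle}$, $Y\in\log\Gamma_N$, form an orthonormal basis of $L^2(C,d\xi)$. Then the family $\big(\pi(\ell^{-1}\kappa)\mathbf f\big)_{(\ell,\kappa)\in\Gamma_H\times\Gamma_N}$ is a frame of $\mathfrak H$ with frame bounds $0<m|C|\le M|C|<\infty$, that is, $$m|C|\,\|g\|^2\le\sum_{\ell\in\Gamma_H}\sum_{\kappa\in\Gamma_N}|\langle g,\pi(\ell^{-1}\kappa)\mathbf f\rangle|^2\le M|C|\,\|g\|^2\qquad(g\in\mathfrak H).$$ Moreover: 1. if $m=M$, then this family is a tight frame of $\mathfrak H$;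 2. if $m=M=|C|^{-1}$ and $\int_H|\mathbf f|^2\,d\mu_H=1$, then this family is an orthonormal basis of $\mathfrak H$. -/

import Mathlib

open MeasureTheory Manifold
open scoped ContDiff ENNReal InnerProductSpace

noncomputable section

namespace HLocalized

/-! ### Frames, tight frames, orthonormal bases -/

/-- The indexed family `v` is a frame of the Hilbert space `V` with frame bounds `0 < A ≤ B`. -/
structure IsFrameWithBounds {ι V : Type*} [NormedAddCommGroup V] [InnerProductSpace ℂ V]
    (v : ι → V) (A B : ℝ) : Prop where
  pos : 0 < A
  le : A ≤ B
  summable : ∀ g : V, Summable fun i => ‖⟪g, v i⟫_ℂ‖ ^ 2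
  lower : ∀ g : V, A * ‖g‖ ^ 2 ≤ ∑' i, ‖⟪g, v i⟫_ℂ‖ ^ 2
  upper : ∀ g : V, ∑' i, ‖⟪g, v i⟫_ℂ‖ ^ 2 ≤ B * ‖g‖ ^ 2

/-- A tight frame: the two frame bounds can be chosen to be equal. -/
def IsTightFrame {ι V : Type*} [NormedAddCommGroup V] [InnerProductSpace ℂ V]
    (v : ι → V) : Prop :=
  ∃ A : ℝ, IsFrameWithBounds v A A

/-- The indexed family `v` is an orthonormal basis of the Hilbert space `V`. -/
def IsOrthonormalBasis {ι V : Type*} [NormedAddCommGroup V] [InnerProductSpace ℂ V]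
    (v : ι → V) : Prop :=
  ∃ b : HilbertBasis ι ℂ V, (b : ι → V) = v

/-! ### Multiplication by a unimodular function -/

theorem memLp_phase {X : Type*} [TopologicalSpace X] [MeasurableSpace X] [OpensMeasurableSpace X]
    {μ : Measure X} {θ : X → ℝ} (hθ : Continuous θ) (g : Lp ℂ 2 μ) :
    MemLp (fun x => Complex.exp (2 * Real.pi * Complex.I * θ x) * g x) 2 μ := by
  have hc : Continuous fun x => Complex.exp (2 * Real.pi * Complex.I * θ x) := by fun_prop
  refine (Lp.memLp g).of_le (hc.measurable.aestronglyMeasurable.mul (Lp.aestronglyMeasurable g))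
    (Filter.Eventually.of_forall fun x => ?_)
  have h : 2 * (Real.pi : ℂ) * Complex.I * θ x = ((2 * Real.pi * θ x : ℝ) : ℂ) * Complex.I := by
    push_cast; ring
  rw [norm_mul, h, Complex.norm_exp_ofReal_mul_I, one_mul]

/-- The isometry `g ↦ e^{2πiθ} g` of `L²(μ)`, for a continuous real function `θ`. -/
def mulPhase {X : Type*} [TopologicalSpace X] [MeasurableSpace X] [OpensMeasurableSpace X]
    (μ : Measure X) (θ : X → ℝ) (hθ : Continuous θ) : Lp ℂ 2 μ →ₗᵢ[ℂ] Lp ℂ 2 μ where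
  toFun g := (memLp_phase hθ g).toLp
    (fun x => Complex.exp (2 * Real.pi * Complex.I * θ x) * g x)
  map_add' g₁ g₂ := by
    rw [← MemLp.toLp_add, MemLp.toLp_eq_toLp_iff]
    filter_upwards [Lp.coeFn_add g₁ g₂] with x hx
    rw [hx, Pi.add_apply, Pi.add_apply, mul_add]
  map_smul' c g := by
    rw [RingHom.id_apply, ← MemLp.toLp_const_smul, MemLp.toLp_eq_toLp_iff]
    filter_upwards [Lp.coeFn_smul c g] with x hx
    rw [hx, Pi.smul_apply, Pi.smul_apply, smul_eq_mul, smul_eq_mul]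
    ring
  norm_map' g := by
    change ‖(memLp_phase hθ g).toLp _‖ = ‖g‖
    rw [Lp.norm_toLp, Lp.norm_def]
    congr 1
    refine eLpNorm_congr_norm_ae (Filter.Eventually.of_forall fun x => ?_)
    have h : 2 * (Real.pi : ℂ) * Complex.I * θ x = ((2 * Real.pi * θ x : ℝ) : ℂ) * Complex.I := by
      push_cast; ring
    rw [norm_mul, h, Complex.norm_exp_ofReal_mul_I, one_mul]

/-- Left translation `(L_z g)(h) = g(z⁻¹ h)` as an isometry of `L²(μ)`, for `μ` left invariant. -/
def translation {K : Type*} [Group K] [MeasurableSpace K] [MeasurableMul K] (μ : Measure K)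
    [μ.IsMulLeftInvariant] (z : K) : Lp ℂ 2 μ →ₗᵢ[ℂ] Lp ℂ 2 μ :=
  Lp.compMeasurePreservingₗᵢ ℂ (fun h => z⁻¹ * h) (measurePreserving_mul_left μ z⁻¹)

/-! ### Exponential map, logarithm, adjoint action -/

section Lie

variable {EG EN EH : Type*} [NormedAddCommGroup EG] [NormedSpace ℝ EG]
  [NormedAddCommGroup EN] [NormedSpace ℝ EN] [NormedAddCommGroup EH] [NormedSpace ℝ EH]

instance lieGroup_minSmoothness {N : Type*} [Group N] [TopologicalSpace N] [ChartedSpace EN N]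
    [LieGroup 𝓘(ℝ, EN) ∞ N] : LieGroup 𝓘(ℝ, EN) (minSmoothness ℝ 3) N := by
  rw [minSmoothness_of_isRCLikeNormedField]; infer_instance

/-- `γ` is the one-parameter subgroup of the Lie group `N` with initial velocity `X`. -/
def IsOneParameterSubgroup {N : Type*} [Group N] [TopologicalSpace N] [ChartedSpace EN N]
    (γ : ℝ → N) (X : GroupLieAlgebra 𝓘(ℝ, EN) N) : Prop :=
  (∀ s t : ℝ, γ (s + t) = γ s * γ t) ∧
    HasMFDerivAt 𝓘(ℝ, ℝ) 𝓘(ℝ, EN) γ 0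
      ((ContinuousLinearMap.toSpanSingleton ℝ (X : EN) : ℝ →L[ℝ] EN))

open Classical in
/-- The Lie group exponential `X ↦ γ_X(1)`, where `γ_X` is the one-parameter subgroup with initial
velocity `X`. -/
def lieExp {N : Type*} [Group N] [TopologicalSpace N] [ChartedSpace EN N]
    (X : GroupLieAlgebra 𝓘(ℝ, EN) N) : N :=
  if h : ∃ γ : ℝ → N, IsOneParameterSubgroup γ X then h.choose 1 else 1

/-- The logarithm of `N`: the inverse of the exponential map, when the latter is injective. -/
def lieLog {N : Type*} [Group N] [TopologicalSpace N] [ChartedSpace EN N] (x : N) :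
    GroupLieAlgebra 𝓘(ℝ, EN) N :=
  Function.invFun (lieExp (EN := EN) (N := N)) x

/-- `N` is an exponential solvable Lie group: its Lie algebra is solvable and
`exp : 𝔫 → N` is a global diffeomorphism. -/
structure IsExponentialSolvable (EN : Type*) [NormedAddCommGroup EN] [NormedSpace ℝ EN]
    [FiniteDimensional ℝ EN] (N : Type*) [Group N] [TopologicalSpace N] [ChartedSpace EN N]
    [LieGroup 𝓘(ℝ, EN) ∞ N] : Prop where
  solvable : LieAlgebra.IsSolvable (GroupLieAlgebra 𝓘(ℝ, EN) N)
  exp_diffeo : ∃ Φ : Diffeomorph 𝓘(ℝ, EN) 𝓘(ℝ, EN) EN N ∞, ∀ X : EN, Φ X = lieExp X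

variable {G : Type*} [Group G] [TopologicalSpace G] [ChartedSpace EG G]

/-- `S`, with the given Lie group structure on it, is a closed Lie subgroup of `G`. -/
structure IsClosedLieSubgroup (EG : Type*) [NormedAddCommGroup EG] [NormedSpace ℝ EG]
    (ES : Type*) [NormedAddCommGroup ES] [NormedSpace ℝ ES]
    {G : Type*} [Group G] [TopologicalSpace G] [ChartedSpace EG G]
    (S : Subgroup G) [ChartedSpace ES S] : Prop where
  isClosed : IsClosed (S : Set G)
  isSmoothEmbedding : IsSmoothEmbedding 𝓘(ℝ, ES) 𝓘(ℝ, EG) ∞ (Subtype.val : S → G)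

/-- `Ad(s)` on the Lie algebra `𝔫` of the normal subgroup `N`: the differential at the identity of
the conjugation `y ↦ s y s⁻¹`. -/
def Ad (N : Subgroup G) [N.Normal] [ChartedSpace EN N] (s : G) :
    GroupLieAlgebra 𝓘(ℝ, EN) N →L[ℝ] GroupLieAlgebra 𝓘(ℝ, EN) N :=
  (mfderiv 𝓘(ℝ, EN) 𝓘(ℝ, EN) (fun y : N => MulAut.conjNormal s y) 1 : EN →L[ℝ] EN)

/-- `β_λ(h) = Ad(h⁻¹)^* λ ∈ 𝔫^*`. -/
def beta (N H : Subgroup G) [N.Normal] [ChartedSpace EN N]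
    (lam : Module.Dual ℝ (GroupLieAlgebra 𝓘(ℝ, EN) N)) (h : H) :
    Module.Dual ℝ (GroupLieAlgebra 𝓘(ℝ, EN) N) :=
  lam ∘ₗ (Ad (EN := EN) N (h : G)⁻¹).toLinearMap


theorem contMDiff_conj [LieGroup 𝓘(ℝ, EG) ∞ G] {N H : Subgroup G} [N.Normal]
    [ChartedSpace EN N] [ChartedSpace EH H]
    (hN : IsClosedLieSubgroup EG EN N) (hH : IsClosedLieSubgroup EG EH H) :
    ContMDiff (𝓘(ℝ, EH).prod 𝓘(ℝ, EN)) 𝓘(ℝ, EN) ∞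
      (fun p : H × N => MulAut.conjNormal (p.1 : G) p.2) := by
  have key : ContMDiff (𝓘(ℝ, EH).prod 𝓘(ℝ, EN)) 𝓘(ℝ, EG) ∞
      (fun p : H × N => (p.1 : G) * (p.2 : G) * (p.1 : G)⁻¹) := by
    have h1 : ContMDiff (𝓘(ℝ, EH).prod 𝓘(ℝ, EN)) 𝓘(ℝ, EG) ∞ (fun p : H × N => (p.1 : G)) :=
      hH.isSmoothEmbedding.contMDiff.comp contMDiff_fst
    have h2 : ContMDiff (𝓘(ℝ, EH).prod 𝓘(ℝ, EN)) 𝓘(ℝ, EG) ∞ (fun p : H × N => (p.2 : G)) :=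
      hN.isSmoothEmbedding.contMDiff.comp contMDiff_snd
    exact (h1.mul h2).mul h1.inv
  refine (ContMDiff.iff_comp_isImmersion hN.isSmoothEmbedding.isImmersion).2 ⟨?_, ?_⟩
  · exact Continuous.subtype_mk key.continuous _
  · exact key

theorem continuous_beta [LieGroup 𝓘(ℝ, EG) ∞ G] [FiniteDimensional ℝ EN] {N H : Subgroup G}
    [N.Normal] [ChartedSpace EN N] [ChartedSpace EH H]
    [LieGroup 𝓘(ℝ, EN) ∞ N] [LieGroup 𝓘(ℝ, EH) ∞ H]
    (hN : IsClosedLieSubgroup EG EN N) (hH : IsClosedLieSubgroup EG EH H)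
    (lam : Module.Dual ℝ (GroupLieAlgebra 𝓘(ℝ, EN) N)) (X : GroupLieAlgebra 𝓘(ℝ, EN) N) :
    Continuous fun h : H => beta N H lam h X := by
  let Y : EN := X
  let l : EN →ₗ[ℝ] ℝ := lam
  let A : G → EN →L[ℝ] EN := fun s => Ad (EN := EN) N s
  have hAd : Continuous fun h : H => A (h : G) := by
    refine continuous_iff_continuousAt.2 fun h₀ => ?_
    have h1 := ContMDiffAt.mfderiv (I := 𝓘(ℝ, EN)) (I' := 𝓘(ℝ, EN)) (x₀ := h₀) (m := 0) (n := ∞)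
      (fun (h : H) (y : N) => (MulAut.conjNormal (h : G) y : N)) (fun _ => (1 : N))
      ((contMDiff_conj hN hH).contMDiffAt) contMDiffAt_const (by simp)
    have h2 : ContinuousAt (inTangentCoordinates 𝓘(ℝ, EN) 𝓘(ℝ, EN) (fun _ : H => (1 : N))
      (fun h : H => (MulAut.conjNormal (h : G) (1 : N) : N)) (fun h : H => A (h : G)) h₀) h₀ :=
      h1.continuousAt
    refine h2.congr (Filter.Eventually.of_forall fun h => ?_)
    rw [inTangentCoordinates_eq (x₀ := h₀) (x := h) (fun _ : H => (1 : N)) _ _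
      (mem_chart_source _ _) (by simp only [map_one]; exact mem_chart_source _ _)]
    ext v
    change _ = (A (h : G)) v
    simp only [ContinuousLinearMap.comp_apply, map_one]
    rw [(tangentBundleCore 𝓘(ℝ, EN) N).coordChange_self _ _ (mem_chart_source _ _),
      (tangentBundleCore 𝓘(ℝ, EN) N).coordChange_self _ _ (mem_chart_source _ _)]
  have hinv : Continuous fun h : H => h⁻¹ := (contMDiff_inv 𝓘(ℝ, EH) ∞ (G := H)).continuous
  have h3 : Continuous fun h : H => A (h : G)⁻¹ Y :=
    (hAd.comp hinv).clm_apply continuous_const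
  have hl : Continuous l := LinearMap.continuous_of_finiteDimensional l
  exact hl.comp h3

/-! ### The induced representation -/

/-- The representation `π = ind_N^{NH}(χ_λ)` of `G = NH`, `N ∩ H = {1}`, realized on `L²(H, μ)` by
`π(x) g (h) = e^{2πi ⟨Ad(h⁻¹)^* λ, log x⟩} g(h)` for `x ∈ N` and `π(z) g (h) = g(z⁻¹ h)` for
`z ∈ H`. As `N` is normal, every element of `G` is uniquely of the form `z x` with `z ∈ H` and
`x ∈ N`, and `π(z x) = π(z) π(x)`. -/
def inducedRep [LieGroup 𝓘(ℝ, EG) ∞ G] [FiniteDimensional ℝ EN] {N H : Subgroup G}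
    [N.Normal] [ChartedSpace EN N] [ChartedSpace EH H]
    [LieGroup 𝓘(ℝ, EN) ∞ N] [LieGroup 𝓘(ℝ, EH) ∞ H]
    (hN : IsClosedLieSubgroup EG EN N) (hH : IsClosedLieSubgroup EG EH H)
    (hNH : Subgroup.IsComplement' N H) (lam : Module.Dual ℝ (GroupLieAlgebra 𝓘(ℝ, EN) N))
    [MeasurableSpace H] [BorelSpace H] (μ : Measure H) [μ.IsHaarMeasure] (g : G) :
    Lp ℂ 2 μ →ₗᵢ[ℂ] Lp ℂ 2 μ :=
  haveI : ContinuousMul H := continuousMul_of_contMDiffMul 𝓘(ℝ, EH) ∞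
  (translation μ (hNH.symm.equiv g).1).comp
    (mulPhase μ (fun h => beta N H lam h (lieLog (EN := EN) (hNH.symm.equiv g).2))
      (continuous_beta hN hH lam _))

/-! ### The local diffeomorphism `Θ_λ` and the density `W_λ` -/

section Chart

variable {N H : Subgroup G} [N.Normal] [ChartedSpace EN N] [ChartedSpace EH H]
  (lam : Module.Dual ℝ (GroupLieAlgebra 𝓘(ℝ, EN) N)) {n : ℕ}
  (b : Module.Basis (Fin n) ℝ (GroupLieAlgebra 𝓘(ℝ, EN) N)) (J : Finset (Fin n))
  (φ : OpenPartialHomeomorph H EH)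

/-- `Θ_λ = P^* β_λ φ⁻¹`, where `P = P_J` is the projection of `𝔫` with `P X_k = X_k` for `k ∈ J` and
`P X_k = 0` for `k ∉ J`. The space `𝔭^* = P^*(𝔫^*)` is identified with `ℝ^J` through its basis
`(X_j^*)_{j ∈ J}`, so that `P^* ω` has the coordinates `⟨ω, X_j⟩`, `j ∈ J`. The model space `EH` is
the Lie algebra of `H`. -/
def theta (A : EH) : J → ℝ := fun j => beta N H lam (φ.symm A) (b j)

/-- `φ` is a smooth chart of `H` with domain `𝒪 = φ.source` an open neighbourhood of the identity,
`φ(1) = 0`, and `Θ_λ` is a diffeomorphism of `φ(𝒪) = φ.target` onto an open subset of `𝔭^*`. -/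
structure IsAdmissibleChart [LieGroup 𝓘(ℝ, EH) ∞ H] : Prop where
  mem_maximalAtlas : φ ∈ IsManifold.maximalAtlas 𝓘(ℝ, EH) ∞ H
  one_mem : (1 : H) ∈ φ.source
  map_one : φ 1 = 0
  theta_diffeo : ∃ Ψ : OpenPartialHomeomorph EH (J → ℝ), Ψ.source = φ.target ∧
    Set.EqOn Ψ (theta lam b J φ) φ.target ∧
    ContDiffOn ℝ ∞ Ψ Ψ.source ∧ ContDiffOn ℝ ∞ Ψ.symm Ψ.target

variable [MeasurableSpace H] (μ : Measure H)

/-- `W_λ(ξ) = dμ_H(φ⁻¹(Θ_λ⁻¹(ξ))) / dξ`: the Radon-Nikodym derivative, with respect to Lebesgue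
measure on `𝔭^* = ℝ^J`, of the image of `μ_H` restricted to `𝒪` under `Θ_λ ∘ φ`. -/
def densityW : (J → ℝ) → ℝ≥0∞ :=
  (Measure.map (fun h => theta lam b J φ (φ h)) (μ.restrict φ.source)).rnDeriv volume

/-- `w(h) = W_λ(Θ_λ(φ(h)))`; only its values for `h ∈ 𝒪` matter. -/
def weight (h : H) : ℝ≥0∞ := densityW lam b J φ μ (theta lam b J φ (φ h))

/-- `∑_{ℓ ∈ Γ_H} |f(ℓh)|² w(ℓh)`, as an element of `[0, ∞]`. -/
def orbitSum (ΓH : Set H) (f : H → ℂ) (h : H) : ℝ≥0∞ :=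
  ∑' l : ΓH, ‖f (l * h)‖ₑ ^ 2 * weight lam b J φ μ (l * h)

/-- `m_{H,f}`. -/
def lowerConst (ΓH : Set H) (f : H → ℂ) : ℝ≥0∞ := essInf (orbitSum lam b J φ μ ΓH f) μ

/-- `M_{H,f}`. -/
def upperConst (ΓH : Set H) (f : H → ℂ) : ℝ≥0∞ := essSup (orbitSum lam b J φ μ ΓH f) μ

end Chart

/-! ### Trigonometric systems -/

section Exponentials

variable {𝔫 : Type*} [AddCommGroup 𝔫] [Module ℝ 𝔫] {n : ℕ} (b : Module.Basis (Fin n) ℝ 𝔫)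
  (J : Finset (Fin n))

/-- The function `ξ ↦ |C|^{-1/2} e^{2πi ⟨ξ, Y⟩}` on `𝔭^* = ℝ^J`, where `Y` is in the span `𝔭` of
`X_j`, `j ∈ J`. -/
def expFun (C : Set (J → ℝ)) (Y : 𝔫) (ξ : J → ℝ) : ℂ :=
  Complex.exp (2 * Real.pi * Complex.I * ((∑ j : J, ξ j * b.repr Y j : ℝ) : ℂ)) /
    (Real.sqrt (volume.real C) : ℂ)

theorem memLp_expFun {C : Set (J → ℝ)} (hC : volume C ≠ ⊤) (Y : 𝔫) :
    MemLp (expFun b J C Y) 2 (volume.restrict C) := by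
  have : IsFiniteMeasure (volume.restrict C) := ⟨by simpa using hC.lt_top⟩
  have hc : Continuous (expFun b J C Y) := by unfold expFun; fun_prop
  refine MemLp.of_bound hc.aestronglyMeasurable (1 / Real.sqrt (volume.real C))
    (Filter.Eventually.of_forall fun ξ => ?_)
  have h : 2 * (Real.pi : ℂ) * Complex.I * ((∑ j : J, ξ j * b.repr Y j : ℝ) : ℂ)
      = ((2 * Real.pi * (∑ j : J, ξ j * b.repr Y j) : ℝ) : ℂ) * Complex.I := by
    push_cast; ring
  rw [expFun, norm_div, h, Complex.norm_exp_ofReal_mul_I, Complex.norm_real, Real.norm_eq_abs,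
    abs_of_nonneg (Real.sqrt_nonneg _)]

/-- The class in `L²(C, dξ)` of `ξ ↦ |C|^{-1/2} e^{2πi ⟨ξ, Y⟩}`. -/
def expVec {C : Set (J → ℝ)} (hC : volume C ≠ ⊤) (Y : 𝔫) : Lp ℂ 2 (volume.restrict C) :=
  (memLp_expFun b J hC Y).toLp (expFun b J C Y)

end Exponentials

end Lie

end HLocalized

end

/-! After the substitution `h ↦ ℓ⁻¹h`, the coefficient of `g` against `π(ℓ⁻¹κ)f` is the integral
over `H` of `conj (g(ℓ⁻¹h)) f(h)` times the phase `exp(2πi⟨β_λ(h), log κ⟩)`. Since `log κ` lies in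
`𝔭`, the phase sees `h` only through `P^*β_λ(h)`, and on `𝒪`, which contains the support of `f`,
this is an injective coordinate with values in `C`. In that coordinate Haar measure has density `W`,
so for fixed `ℓ` the coefficients are, up to conjugation and the factor `√|C|`, those of one
function on `C` against an orthonormal basis of `L²(C)`.

Parseval (`tsum_enorm_integral_mul_comp_sq`) evaluates the sum over `κ` as `|C| ∫ |g(ℓ⁻¹h)|² |f(h)|²
w(h) dh`. Translating back and summing over `ℓ` gives `|C| ∫ |g|² · orbitSum`
(`tsum_enorm_inner_eq_lintegral_orbitSum`), and the essential bounds `m`, `M` of `orbitSum` become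
the frame bounds. That the density exists is `map_restrict_haar_absolutelyContinuous`. If both
bounds equal 1 and the vectors have norm 1, Parseval forces orthonormality and completeness
(`IsFrameWithBounds.isOrthonormalBasis`).

Working in `[0, ∞]` makes sums and integrals commute freely; finiteness is needed only to place the
expanded function in `L²(C)`. -/

namespace HLocalized

/-! ### Frames in terms of extended norms -/

section Frames

variable {ι V : Type*} [NormedAddCommGroup V] [InnerProductSpace ℂ V]

/-- Parseval's identity for a Hilbert basis, in extended norms. -/
theorem tsum_enorm_inner_sq (b : HilbertBasis ι ℂ V) (g : V) :
    ∑' i, ‖⟪g, b i⟫_ℂ‖ₑ ^ 2 = ‖g‖ₑ ^ 2 := by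
  have h : HasSum (fun i => ‖⟪g, b i⟫_ℂ‖ ^ 2) (‖g‖ ^ 2) := by
    have h1 := Complex.hasSum_re (b.hasSum_inner_mul_inner g g)
    have h2 : (⟪g, g⟫_ℂ).re = ‖g‖ ^ 2 := inner_self_eq_norm_sq (𝕜 := ℂ) g
    rw [h2] at h1
    refine h1.congr_fun fun i => ?_
    rw [← inner_conj_symm (b i) g, RCLike.mul_conj]
    norm_cast
  have h3 := ENNReal.ofReal_tsum_of_nonneg (fun i => sq_nonneg ‖⟪g, b i⟫_ℂ‖) h.summable
  rw [h.tsum_eq, ENNReal.ofReal_pow (norm_nonneg _), ofReal_norm] at h3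
  rw [h3]
  refine tsum_congr fun i => ?_
  rw [ENNReal.ofReal_pow (norm_nonneg _), ofReal_norm]

/-- Frame bounds may be checked in extended norms. -/
theorem IsFrameWithBounds.of_enorm {v : ι → V} {A B : ℝ≥0∞} (hA : A ≠ 0) (hAB : A ≤ B)
    (hB : B ≠ ⊤) (hl : ∀ g : V, A * ‖g‖ₑ ^ 2 ≤ ∑' i, ‖⟪g, v i⟫_ℂ‖ₑ ^ 2)
    (hu : ∀ g : V, ∑' i, ‖⟪g, v i⟫_ℂ‖ₑ ^ 2 ≤ B * ‖g‖ₑ ^ 2) :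
    IsFrameWithBounds v A.toReal B.toReal := by
  have hfin : ∀ g : V, B * ‖g‖ₑ ^ 2 ≠ ⊤ := fun g =>
    ENNReal.mul_ne_top hB (ENNReal.pow_ne_top enorm_ne_top)
  have hS : ∀ g : V, ∑' i, ‖⟪g, v i⟫_ℂ‖ₑ ^ 2 ≠ ⊤ := fun g => ne_top_of_le_ne_top (hfin g) (hu g)
  have hreal : ∀ g : V, (∑' i, ‖⟪g, v i⟫_ℂ‖ₑ ^ 2).toReal = ∑' i, ‖⟪g, v i⟫_ℂ‖ ^ 2 := fun g => by
    rw [ENNReal.tsum_toReal_eq fun i => ENNReal.pow_ne_top enorm_ne_top]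
    simp
  refine ⟨ENNReal.toReal_pos hA (ne_top_of_le_ne_top hB hAB), ENNReal.toReal_mono hB hAB,
    fun g => ?_, fun g => ?_, fun g => ?_⟩
  · simpa using ENNReal.summable_toReal (hS g)
  · simpa [hreal] using ENNReal.toReal_mono (hS g) (hl g)
  · simpa [hreal] using ENNReal.toReal_mono (hfin g) (hu g)

/-- A Parseval frame consisting of unit vectors is an orthonormal basis. -/
theorem IsFrameWithBounds.isOrthonormalBasis [CompleteSpace V] {v : ι → V}
    (h : IsFrameWithBounds v 1 1) (hv : ∀ i, ‖v i‖ = 1) : IsOrthonormalBasis v := by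
  classical
  have key : ∀ g : V, HasSum (fun i => ‖⟪g, v i⟫_ℂ‖ ^ 2) (‖g‖ ^ 2) := fun g => by
    have := (h.summable g).hasSum
    rwa [le_antisymm (h.upper g) (h.lower g), one_mul] at this
  have hon : Orthonormal ℂ v := by
    refine ⟨hv, fun i j hij => ?_⟩
    -- Parseval for `g = v i`: the term of index `i` already equals `‖v i‖² = 1`, so nothing is left
    -- for index `j`.
    have h1 := sum_le_hasSum {i, j} (fun k _ => sq_nonneg ‖⟪v i, v k⟫_ℂ‖) (key (v i))
    rw [Finset.sum_pair hij, inner_self_eq_norm_sq_to_K, hv] at h1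
    have h2 : ‖⟪v i, v j⟫_ℂ‖ ^ 2 ≤ 0 := by
      norm_num at h1 ⊢
      exact h1
    exact norm_eq_zero.1 (pow_eq_zero_iff two_ne_zero |>.1 (le_antisymm h2 (sq_nonneg _)))
  refine ⟨HilbertBasis.mkOfOrthogonalEqBot hon ?_, HilbertBasis.coe_mkOfOrthogonalEqBot hon _⟩
  rw [Submodule.eq_bot_iff]
  intro g hg
  have h0 : ∀ i, ‖⟪g, v i⟫_ℂ‖ ^ 2 = 0 := fun i => by
    rw [Submodule.mem_orthogonal'] at hg
    rw [hg _ (Submodule.subset_span ⟨i, rfl⟩)]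
    simp
  have h1 := key g
  simp only [h0] at h1
  simpa using h1.unique hasSum_zero

end Frames

/-! ### Parseval's identity transported along an injective map -/

theorem enorm_Lp_two_sq {X : Type*} [MeasurableSpace X] {μ : Measure X} (g : Lp ℂ 2 μ) :
    ‖g‖ₑ ^ 2 = ∫⁻ x, ‖g x‖ₑ ^ 2 ∂μ := by
  have h := eLpNorm_nnreal_pow_eq_lintegral (f := g) (μ := μ) (p := 2) two_ne_zero
  rw [Lp.enorm_def]
  simpa using h

theorem measurable_enorm_Lp_sq {X : Type*} [MeasurableSpace X] {μ : Measure X} (g : Lp ℂ 2 μ) :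
    Measurable fun x => ‖g x‖ₑ ^ 2 :=
  (Lp.stronglyMeasurable g).measurable.enorm.pow_const 2

/-- Let `T` be injective on `O`, with values in `C`, and let `W` be the density of the image of
`μ` restricted to `O`. For an orthonormal basis `ψ` of `L²(C)`, the coefficients of `F` against
`ψ ∘ T` have square sum `∫ |F|² (W ∘ T) dμ`. -/
theorem tsum_enorm_integral_mul_comp_sq {X Y ι : Type*} [MeasurableSpace X] [MeasurableSpace Y]
    {μ : Measure X} [SigmaFinite μ] {vol : Measure Y} [SigmaFinite vol]
    {O : Set X} (hO : MeasurableSet O) {C : Set Y} (hC : MeasurableSet C)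
    {T : X → Y} (hT : Measurable T) {s : Y → X} (hs : Measurable s)
    (hsT : ∀ x ∈ O, s (T x) = x) (hTC : ∀ x ∈ O, T x ∈ C)
    (hac : Measure.map T (μ.restrict O) ≪ vol)
    {ψ : ι → Y → ℂ} (hψ : ∀ i, MemLp (ψ i) 2 (vol.restrict C))
    (hψm : ∀ i, Measurable (ψ i))
    (hb : IsOrthonormalBasis fun i => (hψ i).toLp (ψ i))
    {F : X → ℂ} (hF : Measurable F) (hFO : ∀ x ∉ O, F x = 0)
    (hfin : ∫⁻ x, ‖F x‖ₑ ^ 2 * (Measure.map T (μ.restrict O)).rnDeriv vol (T x) ∂μ ≠ ⊤) :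
    ∑' i, ‖∫ x, F x * ψ i (T x) ∂μ‖ₑ ^ 2 =
      ∫⁻ x, ‖F x‖ₑ ^ 2 * (Measure.map T (μ.restrict O)).rnDeriv vol (T x) ∂μ := by
  set ν := Measure.map T (μ.restrict O) with hν
  set W := ν.rnDeriv vol with hW
  have hWm : Measurable W := Measure.measurable_rnDeriv _ _
  have hmap : Measure.map s ν = μ.restrict O := by
    rw [hν, Measure.map_map hs hT]
    refine (Measure.map_congr (g := id) ?_).trans Measure.map_id
    filter_upwards [ae_restrict_mem hO] with x hx using hsT x hx
  -- An image of a σ-finite measure need not be σ-finite; here `s` carries `ν` back to `μ`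
  -- restricted to `O`.
  have hσ : SigmaFinite ν := by
    refine SigmaFinite.of_map ν hs.aemeasurable ?_
    rw [hmap]; infer_instance
  have hd : vol.withDensity W = ν := Measure.withDensity_rnDeriv_eq _ _ hac
  have hWtop : ∀ᵐ y ∂vol, W y < ⊤ := Measure.rnDeriv_lt_top _ _
  -- change of variables
  have hνC : ν.restrict C = ν := by
    refine Measure.restrict_eq_self_of_ae_mem ?_
    refine (ae_map_iff hT.aemeasurable hC).2 ?_
    filter_upwards [ae_restrict_mem hO] with x hx using hTC x hx
  have hdC : (vol.restrict C).withDensity W = ν := by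
    rw [← restrict_withDensity hC, hd, hνC]
  have hint : ∀ u : Y → ℂ, Measurable u →
      ∫ y in C, ((W y).toReal : ℂ) * (F (s y) * u y) ∂vol = ∫ x, F x * u (T x) ∂μ := by
    intro u hu
    have h1 := integral_withDensity_eq_integral_toReal_smul hWm (ae_restrict_of_ae hWtop (s := C))
      (fun y => F (s y) * u y)
    rw [hdC] at h1
    simp only [Complex.real_smul] at h1
    have hm : Measurable fun y => F (s y) * u y := (hF.comp hs).mul hu
    rw [← h1, hν, integral_map hT.aemeasurable hm.aestronglyMeasurable]
    rw [setIntegral_congr_fun hO (g := fun x => F x * u (T x))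
      (fun x hx => by simp only [hsT x hx])]
    exact setIntegral_eq_integral_of_forall_compl_eq_zero fun x hx => by rw [hFO x hx, zero_mul]
  -- The squared norm of `(F ∘ s) W` contains `W` twice: one factor turns `vol` into `ν`, the other
  -- survives as the weight.
  have hlint : ∫⁻ y in C, ‖F (s y)‖ₑ ^ 2 * W y * W y ∂vol = ∫⁻ x, ‖F x‖ₑ ^ 2 * W (T x) ∂μ := by
    have hm : Measurable fun y => ‖F (s y)‖ₑ ^ 2 * W y :=
      ((hF.comp hs).enorm.pow_const 2).mul hWm
    have h1 := lintegral_withDensity_eq_lintegral_mul (vol.restrict C) hWm hm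
    rw [hdC, hν, lintegral_map hm hT] at h1
    have h2 : ∫⁻ y in C, ‖F (s y)‖ₑ ^ 2 * W y * W y ∂vol
        = ∫⁻ a in C, (W * fun y => ‖F (s y)‖ₑ ^ 2 * W y) a ∂vol :=
      lintegral_congr fun y => by simp only [Pi.mul_apply]; ring
    rw [h2, ← h1, setLIntegral_congr_fun hO (g := fun x => ‖F x‖ₑ ^ 2 * W (T x))
      (fun x hx => by simp only [hsT x hx])]
    refine setLIntegral_eq_of_support_subset fun x hx => ?_
    by_contra hxO
    exact hx (by simp [hFO x hxO])
  -- the function to be expanded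
  let G : Y → ℂ := fun y => (starRingEnd ℂ) (F (s y)) * ((W y).toReal : ℂ)
  have hGm : Measurable G :=
    (Complex.continuous_conj.measurable.comp (hF.comp hs)).mul
      (Complex.measurable_ofReal.comp hWm.ennreal_toReal)
  have hGn : ∫⁻ y in C, ‖G y‖ₑ ^ 2 ∂vol = ∫⁻ x, ‖F x‖ₑ ^ 2 * W (T x) ∂μ := by
    rw [← hlint]
    refine lintegral_congr_ae (ae_restrict_of_ae ?_)
    filter_upwards [hWtop] with y hy
    have h1 : ‖((W y).toReal : ℂ)‖ₑ = W y := by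
      rw [← ofReal_norm, Complex.norm_real, Real.norm_of_nonneg ENNReal.toReal_nonneg,
        ENNReal.ofReal_toReal hy.ne]
    have h2 : ‖(starRingEnd ℂ) (F (s y))‖ₑ = ‖F (s y)‖ₑ := by
      rw [← ofReal_norm, RCLike.norm_conj, ofReal_norm]
    simp only [G, enorm_mul, h1, h2]
    ring
  have hGL : MemLp G 2 (vol.restrict C) := by
    refine ⟨hGm.aestronglyMeasurable, ?_⟩
    have h := eLpNorm_nnreal_pow_eq_lintegral (f := G) (μ := vol.restrict C) (p := 2) two_ne_zero
    have h' : eLpNorm G 2 (vol.restrict C) ^ 2 = ∫⁻ y in C, ‖G y‖ₑ ^ 2 ∂vol := by simpa using h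
    rw [hGn] at h'
    by_contra hcon
    rw [not_lt, top_le_iff] at hcon
    rw [hcon] at h'
    exact hfin (by simpa using h'.symm)
  obtain ⟨B, hB⟩ := hb
  have hP := tsum_enorm_inner_sq B (hGL.toLp G)
  have hL : ‖hGL.toLp G‖ₑ ^ 2 = ∫⁻ y in C, ‖G y‖ₑ ^ 2 ∂vol := by
    rw [enorm_Lp_two_sq]
    refine lintegral_congr_ae ?_
    filter_upwards [hGL.coeFn_toLp] with y hy
    rw [hy]
  rw [hL, hGn] at hP
  rw [← hP]
  refine tsum_congr fun i => ?_
  -- The inner product conjugates its first argument, which undoes the conjugate in `G` and leaves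
  -- `F ∘ s` times `ψ i`.
  rw [hB, L2.inner_def, ← hint (ψ i) (hψm i)]
  congr 2
  refine integral_congr_ae ?_
  filter_upwards [hGL.coeFn_toLp, (hψ i).coeFn_toLp] with y h1 h2
  rw [h1, h2]
  simp only [G, RCLike.inner_apply, map_mul, Complex.conj_conj, Complex.conj_ofReal]
  ring

/-! ### Absolute continuity of Haar measure in smooth charts -/

/-- The image of a Haar measure of a Lie group under a diffeomorphism of an open subset onto an
open subset of a finite-dimensional space is absolutely continuous. -/
theorem map_restrict_haar_absolutelyContinuous {E F K : Type*} [NormedAddCommGroup E]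
    [NormedSpace ℝ E] [NormedAddCommGroup F] [NormedSpace ℝ F]
    [FiniteDimensional ℝ F] [MeasurableSpace F] [BorelSpace F]
    [Group K] [TopologicalSpace K] [IsTopologicalGroup K] [SecondCountableTopology K]
    [ChartedSpace E K] [LieGroup 𝓘(ℝ, E) ∞ K]
    [MeasurableSpace K] [BorelSpace K] (μ : Measure K) [SFinite μ] [μ.IsMulLeftInvariant]
    (vol : Measure F) [vol.IsAddHaarMeasure]
    (e : OpenPartialHomeomorph K F) (he : e.source.Nonempty)
    (hsm : ContMDiffOn 𝓘(ℝ, E) 𝓘(ℝ, F) ∞ e e.source)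
    (hsm' : ContMDiffOn 𝓘(ℝ, F) 𝓘(ℝ, E) ∞ e.symm e.target)
    {T : K → F} (hT : Measurable T) (hTe : Set.EqOn T e e.source) :
    Measure.map T (μ.restrict e.source) ≪ vol := by
  classical
  obtain ⟨k₀, hk₀⟩ := he
  refine Measure.AbsolutelyContinuous.mk fun A hA hA0 => ?_
  rw [Measure.map_apply hT hA, Measure.restrict_apply (hT hA)]
  set B : Set K := T ⁻¹' A ∩ e.source with hBdef
  have hB : MeasurableSet B := (hT hA).inter e.open_source.measurableSet
  -- a measure on `K` with the same null sets as Lebesgue measure in the chart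
  have hS : Measurable (e.target.piecewise e.symm fun _ => k₀) :=
    e.continuousOn_symm.measurable_piecewise continuousOn_const e.open_target.measurableSet
  set S := e.target.piecewise e.symm fun _ => k₀ with hSdef
  have hSe : ∀ y ∈ e.target, S y = e.symm y := fun y hy => Set.piecewise_eq_of_mem _ _ _ hy
  -- Read in the chart, left translation is a smooth map `u` between open sets. The points that `x`
  -- moves into `B` lie in the `u`-image of part of the null set `A`, and differentiable maps
  -- preserve null sets.
  have hnull : ∀ x : K, vol.restrict e.target {y | x * S y ∈ B} = 0 := by
    intro x
    have hm : MeasurableSet {y | x * S y ∈ B} := (measurable_const.mul hS) hB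
    rw [Measure.restrict_apply hm]
    let D : Set F := {z | z ∈ e.target ∧ x⁻¹ * e.symm z ∈ e.source}
    let u : F → F := fun z => e (x⁻¹ * e.symm z)
    have hu : DifferentiableOn ℝ u (A ∩ D) := by
      have h1 : ContMDiffOn 𝓘(ℝ, F) 𝓘(ℝ, E) ∞ (fun z => x⁻¹ * e.symm z) D :=
        (contMDiff_mul_left (I := 𝓘(ℝ, E)) (n := ∞) (a := x⁻¹)).comp_contMDiffOn
          (hsm'.mono fun z hz => hz.1)
      have h2 : ContMDiffOn 𝓘(ℝ, F) 𝓘(ℝ, F) ∞ u D := hsm.comp h1 fun z hz => hz.2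
      exact ((contMDiffOn_iff_contDiffOn.1 h2).differentiableOn (by simp)).mono
        Set.inter_subset_right
    have h0 := addHaar_image_eq_zero_of_differentiableOn_of_addHaar_eq_zero vol hu
      (measure_mono_null Set.inter_subset_left hA0)
    refine measure_mono_null ?_ h0
    rintro y ⟨hy, hyt⟩
    rw [Set.mem_ofPred_eq, hSe y hyt] at hy
    have hxy : x * e.symm y ∈ e.source := hy.2
    refine ⟨e (x * e.symm y), ⟨?_, e.map_source hxy, ?_⟩, ?_⟩
    · rw [← hTe hxy]; exact hy.1
    · rw [e.left_inv hxy, inv_mul_cancel_left]; exact e.map_target hyt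
    · simp only [u]
      rw [e.left_inv hxy, inv_mul_cancel_left, e.right_inv hyt]
  have hprod : MeasurableSet {p : K × F | p.1 * S p.2 ∈ B} :=
    (measurable_fst.mul (hS.comp measurable_snd)) hB
  have h1 : (μ.prod (vol.restrict e.target)) {p : K × F | p.1 * S p.2 ∈ B} = 0 := by
    rw [Measure.measure_prod_null hprod]
    exact Filter.Eventually.of_forall hnull
  -- Fubini in the other order: some `y` makes the right translate of `B` by `(S y)⁻¹` a `μ`-null
  -- set. Right translation preserves null sets of a left-invariant measure, so `B` is null.
  rw [Measure.prod_apply_symm hprod,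
    lintegral_eq_zero_iff (measurable_measure_prodMk_right hprod)] at h1
  have hne : vol.restrict e.target ≠ 0 := by
    rw [Ne, Measure.restrict_eq_zero]
    exact (e.open_target.measure_pos vol ⟨e k₀, e.map_source hk₀⟩).ne'
  have : (ae (vol.restrict e.target)).NeBot := ae_neBot.2 hne
  obtain ⟨y, hy⟩ := h1.exists
  exact (measure_mul_right_null μ (S y)).1 hy

/-- Coordinates outside `J` vanish on the span, so the pairing with `Y ∈ 𝔭` depends only on `P^*w`.
-/
theorem dual_apply_of_mem_span {𝔫 : Type*} [AddCommGroup 𝔫] [Module ℝ 𝔫] {n : ℕ}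
    (b : Module.Basis (Fin n) ℝ 𝔫) (J : Finset (Fin n)) (w : Module.Dual ℝ 𝔫) {Y : 𝔫}
    (hY : Y ∈ Submodule.span ℝ (b '' J)) : w Y = ∑ j : J, w (b j) * b.repr Y j := by
  rw [Module.Basis.mem_span_image] at hY
  conv_lhs => rw [← b.sum_repr Y]
  rw [map_sum, Finset.sum_coe_sort J fun i => w (b i) * b.repr Y i]
  refine (Finset.sum_subset (Finset.subset_univ J) fun i _ hi => ?_).symm.trans
    (Finset.sum_congr rfl fun i _ => ?_)
  · have : b.repr Y i = 0 := by
      by_contra h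
      exact hi (hY (Finsupp.mem_support_iff.2 h))
    rw [this, zero_smul, map_zero]
  · rw [map_smul, smul_eq_mul, mul_comm]

/-! ### Matrix coefficients of the induced representation -/

section Rep

variable {EG EN EH : Type*} [NormedAddCommGroup EG] [NormedSpace ℝ EG]
  [NormedAddCommGroup EN] [NormedSpace ℝ EN] [FiniteDimensional ℝ EN]
  [NormedAddCommGroup EH] [NormedSpace ℝ EH]
  {G : Type*} [Group G] [TopologicalSpace G]
  [ChartedSpace EG G] [LieGroup 𝓘(ℝ, EG) ∞ G]
  {N H : Subgroup G} [N.Normal] [ChartedSpace EN N] [LieGroup 𝓘(ℝ, EN) ∞ N]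
  [ChartedSpace EH H] [LieGroup 𝓘(ℝ, EH) ∞ H]
  (hN : IsClosedLieSubgroup EG EN N) (hH : IsClosedLieSubgroup EG EH H)
  (hNH : Subgroup.IsComplement' N H)
  (lam : Module.Dual ℝ (GroupLieAlgebra 𝓘(ℝ, EN) N))
  [MeasurableSpace H] [BorelSpace H] (μ : Measure H) [μ.IsHaarMeasure]

/-- The factorization `zx` is unique, and translation acts after multiplication; hence the phase is
evaluated at `z⁻¹h`. -/
theorem inducedRep_mul_coeFn (z : H) (x : N) (g : Lp ℂ 2 μ) :
    inducedRep hN hH hNH lam μ ((z : G) * (x : G)) g =ᵐ[μ] fun h =>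
      Complex.exp (2 * Real.pi * Complex.I *
        (beta N H lam (z⁻¹ * h) (lieLog (EN := EN) x) : ℝ)) * g (z⁻¹ * h) := by
  have : ContinuousMul H := continuousMul_of_contMDiffMul 𝓘(ℝ, EH) ∞
  have heq : hNH.symm.equiv ((z : G) * (x : G)) = (z, x) :=
    (hNH.symm.equiv).eq_symm_apply.1 (hNH.symm.equiv_symm_apply (z, x)).symm
  unfold inducedRep
  simp only [heq]
  have hmp := measurePreserving_mul_left μ z⁻¹
  have h1 := Lp.coeFn_compMeasurePreserving
    (mulPhase μ (fun h => beta N H lam h (lieLog (EN := EN) x)) (continuous_beta hN hH lam _) g) hmp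
  have h2 := hmp.quasiMeasurePreserving.ae
    (memLp_phase (continuous_beta hN hH lam (lieLog (EN := EN) x)) g).coeFn_toLp
  filter_upwards [h1, h2] with h h1 h2
  exact h1.trans h2

theorem norm_inducedRep (s : G) (g : Lp ℂ 2 μ) : ‖inducedRep hN hH hNH lam μ s g‖ = ‖g‖ :=
  LinearIsometry.norm_map _ _

/-- The matrix coefficients of `π(ℓ⁻¹κ)`, after the substitution `h ↦ ℓ⁻¹h`. -/
theorem inner_inducedRep_inv_mul (l : H) (x : N) (g : Lp ℂ 2 μ) {f : H → ℂ} (hf : MemLp f 2 μ) :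
    ⟪g, inducedRep hN hH hNH lam μ ((l : G)⁻¹ * (x : G)) (hf.toLp f)⟫_ℂ =
      ∫ h, (starRingEnd ℂ) (g (l⁻¹ * h)) * f h *
        Complex.exp (2 * Real.pi * Complex.I *
          (beta N H lam h (lieLog (EN := EN) x) : ℝ)) ∂μ := by
  have : ContinuousMul H := continuousMul_of_contMDiffMul 𝓘(ℝ, EH) ∞
  rw [L2.inner_def, ← integral_mul_left_eq_self (fun h => (starRingEnd ℂ) (g (l⁻¹ * h)) * f h *
    Complex.exp (2 * Real.pi * Complex.I * (beta N H lam h (lieLog (EN := EN) x) : ℝ))) l]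
  refine integral_congr_ae ?_
  have h1 := inducedRep_mul_coeFn hN hH hNH lam μ l⁻¹ x (hf.toLp f)
  have h2 := (measurePreserving_mul_left μ l).quasiMeasurePreserving.ae hf.coeFn_toLp
  rw [Subgroup.coe_inv] at h1
  filter_upwards [h1, h2] with h h1 h2
  rw [h1, inv_inv, h2, inv_mul_cancel_left, RCLike.inner_apply]
  ring

end Rep

/-! ### The coordinate `P^*β_λ` on `H` and its density -/

section Chart

variable {EG EN EH : Type*} [NormedAddCommGroup EG] [NormedSpace ℝ EG]
  [NormedAddCommGroup EN] [NormedSpace ℝ EN] [NormedAddCommGroup EH]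
  {G : Type*} [Group G] [TopologicalSpace G]
  {N H : Subgroup G} [N.Normal] [ChartedSpace EN N]
  (lam : Module.Dual ℝ (GroupLieAlgebra 𝓘(ℝ, EN) N))
  {n : ℕ} (b : Module.Basis (Fin n) ℝ (GroupLieAlgebra 𝓘(ℝ, EN) N)) (J : Finset (Fin n))
  (φ : OpenPartialHomeomorph H EH)

/-- The map `h ↦ P^* β_λ(h)` on all of `H`, in coordinates. -/
noncomputable def betaCoord (h : H) : J → ℝ := fun j => beta N H lam h (b j)

/-- The chart cancels on its domain, so the globally defined, continuous `betaCoord` can replace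
`Θ_λ ∘ φ` in all measure-theoretic arguments. -/
theorem theta_chart {h : H} (hh : h ∈ φ.source) :
    theta lam b J φ (φ h) = betaCoord lam b J h := by
  funext j
  rw [theta, φ.left_inv hh, betaCoord]

theorem continuous_betaCoord [FiniteDimensional ℝ EN] [ChartedSpace EG G] [LieGroup 𝓘(ℝ, EG) ∞ G]
    [LieGroup 𝓘(ℝ, EN) ∞ N] [NormedSpace ℝ EH] [ChartedSpace EH H] [LieGroup 𝓘(ℝ, EH) ∞ H]
    (hN : IsClosedLieSubgroup EG EN N) (hH : IsClosedLieSubgroup EG EH H) :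
    Continuous (betaCoord (H := H) lam b J) :=
  continuous_pi fun _ => continuous_beta hN hH lam _

/-- An admissible chart followed by `Θ_λ`, as a diffeomorphism onto an open subset of `ℝ^J`. -/
theorem IsAdmissibleChart.exists_coord [NormedSpace ℝ EH] [ChartedSpace EH H]
    [LieGroup 𝓘(ℝ, EH) ∞ H] {lam : Module.Dual ℝ (GroupLieAlgebra 𝓘(ℝ, EN) N)}
    {b : Module.Basis (Fin n) ℝ (GroupLieAlgebra 𝓘(ℝ, EN) N)} {J : Finset (Fin n)}
    {φ : OpenPartialHomeomorph H EH} (hφ : IsAdmissibleChart lam b J φ) :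
    ∃ e : OpenPartialHomeomorph H (J → ℝ), e.source = φ.source ∧
      Set.EqOn (betaCoord lam b J) e e.source ∧
      ContMDiffOn 𝓘(ℝ, EH) 𝓘(ℝ, J → ℝ) ∞ e e.source ∧
      ContMDiffOn 𝓘(ℝ, J → ℝ) 𝓘(ℝ, EH) ∞ e.symm e.target := by
  obtain ⟨Ψ, hs, heq, h1, h2⟩ := hφ.theta_diffeo
  refine ⟨φ.trans' Ψ hs.symm, rfl, fun h hh => ?_, ?_, ?_⟩
  · change h ∈ φ.source at hh
    change _ = Ψ (φ h)
    rw [heq (φ.map_source hh), theta_chart lam b J φ hh]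
  · exact (contMDiffOn_iff_contDiffOn.2 h1).comp
      (contMDiffOn_of_mem_maximalAtlas hφ.mem_maximalAtlas)
      fun h hh => hs ▸ φ.map_source hh
  · exact (contMDiffOn_symm_of_mem_maximalAtlas hφ.mem_maximalAtlas).comp
      (contMDiffOn_iff_contDiffOn.2 h2) fun y hy => hs ▸ Ψ.map_target hy

/-- The phases of `π` are the trigonometric system pulled back along `betaCoord`; undoing its
normalization is the source of the factor `|C|` in the frame bounds. -/
theorem exp_eq_expFun {C : Set (J → ℝ)} (hC0 : volume C ≠ 0) (hC : volume C ≠ ⊤)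
    {Y : GroupLieAlgebra 𝓘(ℝ, EN) N} (hY : Y ∈ Submodule.span ℝ (b '' J)) (h : H) :
    Complex.exp (2 * Real.pi * Complex.I * (beta N H lam h Y : ℝ)) =
      (Real.sqrt (volume.real C) : ℂ) * expFun b J C Y (betaCoord lam b J h) := by
  have hs : (Real.sqrt (volume.real C) : ℂ) ≠ 0 := by
    have := ENNReal.toReal_pos hC0 hC
    exact_mod_cast (Real.sqrt_pos.2 this).ne'
  rw [expFun, mul_div_cancel₀ _ hs, dual_apply_of_mem_span b J (beta N H lam h) hY]
  rfl

variable [MeasurableSpace H] (μ : Measure H)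

theorem densityW_eq [BorelSpace H] : densityW lam b J φ μ =
    (Measure.map (betaCoord lam b J) (μ.restrict φ.source)).rnDeriv volume := by
  rw [densityW, Measure.map_congr (g := betaCoord lam b J)]
  filter_upwards [ae_restrict_mem φ.open_source.measurableSet] with h hh
    using theta_chart lam b J φ hh

/-- Off `𝒪` the values of `weight` are arbitrary, but there `f` vanishes; replacing them yields
terms that are visibly measurable. -/
theorem orbitSum_eq {f : H → ℂ} (hfO : Function.support f ⊆ φ.source) (ΓH : Set H) (h : H) :
    orbitSum lam b J φ μ ΓH f h =
      ∑' l : ΓH, ‖f ((l : H) * h)‖ₑ ^ 2 *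
        densityW lam b J φ μ (betaCoord lam b J ((l : H) * h)) := by
  refine tsum_congr fun l => ?_
  by_cases hl : (l * h : H) ∈ φ.source
  · rw [weight, theta_chart lam b J φ hl]
  · have : f (l * h) = 0 := by
      by_contra h0
      exact hl (hfO h0)
    simp [this]

end Chart

/-! ### Summing the squared frame coefficients -/

section Main

variable {EG EN EH : Type*} [NormedAddCommGroup EG] [NormedSpace ℝ EG]
  [NormedAddCommGroup EN] [NormedSpace ℝ EN] [FiniteDimensional ℝ EN]
  [NormedAddCommGroup EH] [NormedSpace ℝ EH] [FiniteDimensional ℝ EH]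
  {G : Type*} [Group G] [TopologicalSpace G] [SecondCountableTopology G]
  [ChartedSpace EG G] [LieGroup 𝓘(ℝ, EG) ∞ G]
  {N H : Subgroup G} [N.Normal] [ChartedSpace EN N] [LieGroup 𝓘(ℝ, EN) ∞ N]
  [ChartedSpace EH H] [LieGroup 𝓘(ℝ, EH) ∞ H]
  (hN : IsClosedLieSubgroup EG EN N) (hH : IsClosedLieSubgroup EG EH H)
  (hNH : Subgroup.IsComplement' N H)
  {lam : Module.Dual ℝ (GroupLieAlgebra 𝓘(ℝ, EN) N)}
  [MeasurableSpace H] [BorelSpace H] {μ : Measure H} [μ.IsHaarMeasure]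
  {n : ℕ} {b : Module.Basis (Fin n) ℝ (GroupLieAlgebra 𝓘(ℝ, EN) N)} {J : Finset (Fin n)}
  {φ : OpenPartialHomeomorph H EH}

/-- The sum over `Γ_N` of the squared frame coefficients, for a fixed element of `Γ_H`. -/
theorem tsum_enorm_inner_inducedRep_sq (hφ : IsAdmissibleChart lam b J φ)
    {f : H → ℂ} (hf : Measurable f) (hf2 : MemLp f 2 μ)
    (hfO : Function.support f ⊆ φ.source)
    {C : Set (J → ℝ)} (hCm : MeasurableSet C) (hC0 : volume C ≠ 0) (hC : volume C ≠ ⊤)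
    (hCO : theta lam b J φ '' φ.target ⊆ C) {ΓN : Set N}
    (hΓNp : ∀ x ∈ ΓN, lieLog (EN := EN) x ∈ Submodule.span ℝ (b '' J))
    (hΓNC : IsOrthonormalBasis fun x : ΓN => expVec b J hC (lieLog (EN := EN) (x : N)))
    (l : H) (g : Lp ℂ 2 μ)
    (hfin : ∫⁻ h, ‖g h‖ₑ ^ 2 *
      (‖f (l * h)‖ₑ ^ 2 * densityW lam b J φ μ (betaCoord lam b J (l * h))) ∂μ ≠ ⊤) :
    ∑' x : ΓN, ‖⟪g, inducedRep hN hH hNH lam μ ((l : G)⁻¹ * ((x : N) : G)) (hf2.toLp f)⟫_ℂ‖ₑ ^ 2 =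
      volume C * ∫⁻ h, ‖g h‖ₑ ^ 2 *
        (‖f (l * h)‖ₑ ^ 2 * densityW lam b J φ μ (betaCoord lam b J (l * h))) ∂μ := by
  classical
  have : IsTopologicalGroup G := topologicalGroup_of_lieGroup 𝓘(ℝ, EG) ∞
  have : SecondCountableTopology H := Topology.IsEmbedding.subtypeVal.secondCountableTopology
  have : LocallyCompactSpace H := Manifold.locallyCompact_of_finiteDimensional 𝓘(ℝ, EH)
  obtain ⟨e, hes, heT, hsm, hsm'⟩ := hφ.exists_coord
  have hT : Measurable (betaCoord (H := H) lam b J) := (continuous_betaCoord lam b J hN hH).measurable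
  have h1 : (1 : H) ∈ e.source := hes ▸ hφ.one_mem
  have hac := map_restrict_haar_absolutelyContinuous μ (volume : Measure (J → ℝ)) e ⟨1, h1⟩
    hsm hsm' hT heT
  -- The local inverse is extended by the constant `1` off `e.target` only to be measurable
  -- everywhere.
  have hs : Measurable (e.target.piecewise e.symm fun _ => (1 : H)) :=
    e.continuousOn_symm.measurable_piecewise continuousOn_const e.open_target.measurableSet
  have hsT : ∀ x ∈ e.source,
      e.target.piecewise e.symm (fun _ => (1 : H)) (betaCoord lam b J x) = x := fun x hx => by
    rw [heT hx, Set.piecewise_eq_of_mem _ _ _ (e.map_source hx), e.left_inv hx]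
  have hTC : ∀ x ∈ e.source, betaCoord lam b J x ∈ C := fun x hx => by
    rw [hes] at hx
    exact hCO ⟨φ x, φ.map_source hx, theta_chart lam b J φ hx⟩
  have hfe : ∀ x ∉ e.source, f x = 0 := fun x hx => by
    by_contra h0
    exact hx (hes ▸ hfO h0)
  let F : H → ℂ := fun h => (starRingEnd ℂ) (g (l⁻¹ * h)) * f h
  have hF : Measurable F :=
    (Complex.continuous_conj.measurable.comp
      ((Lp.stronglyMeasurable g).measurable.comp (measurable_const_mul l⁻¹))).mul hf
  have hFn : ∫⁻ h, ‖F h‖ₑ ^ 2 * densityW lam b J φ μ (betaCoord lam b J h) ∂μ =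
      ∫⁻ h, ‖g h‖ₑ ^ 2 *
        (‖f (l * h)‖ₑ ^ 2 * densityW lam b J φ μ (betaCoord lam b J (l * h))) ∂μ := by
    -- Left invariance moves `l` from `g` to `f` and the density, giving the summand of `orbitSum`.
    rw [← lintegral_mul_left_eq_self _ l]
    refine lintegral_congr fun h => ?_
    have hc : ‖(starRingEnd ℂ) (g h)‖ₑ = ‖g h‖ₑ := by
      rw [← ofReal_norm, RCLike.norm_conj, ofReal_norm]
    simp only [F, inv_mul_cancel_left, enorm_mul, hc]
    ring
  rw [← hFn] at hfin ⊢
  rw [densityW_eq, ← hes] at hfin ⊢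
  have hcont : ∀ Y, Continuous (expFun b J C Y) := fun Y => by unfold expFun; fun_prop
  rw [← tsum_enorm_integral_mul_comp_sq e.open_source.measurableSet hCm hT hs hsT hTC hac
    (fun x : ΓN => memLp_expFun b J hC (lieLog (EN := EN) (x : N)))
    (fun x => (hcont _).measurable) hΓNC hF
    (fun x hx => by simp only [F, hfe x hx, mul_zero]) hfin, ← ENNReal.tsum_mul_left]
  refine tsum_congr fun x => ?_
  have hc : ‖(Real.sqrt (volume.real C) : ℂ)‖ₑ ^ 2 = volume C := by
    rw [← ofReal_norm, Complex.norm_real, Real.norm_of_nonneg (Real.sqrt_nonneg _),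
      ← ENNReal.ofReal_pow (Real.sqrt_nonneg _), Real.sq_sqrt measureReal_nonneg,
      ofReal_measureReal hC]
  rw [inner_inducedRep_inv_mul, ← hc, ← mul_pow, ← enorm_mul, ← integral_const_mul]
  congr 2
  refine integral_congr_ae (Filter.Eventually.of_forall fun h => ?_)
  simp only [F, exp_eq_expFun lam b J hC0 hC (hΓNp x x.2)]
  ring

/-- The sum over `Γ_H × Γ_N` of the squared frame coefficients. -/
theorem tsum_enorm_inner_eq_lintegral_orbitSum (hφ : IsAdmissibleChart lam b J φ)
    {f : H → ℂ} (hf : Measurable f) (hf2 : MemLp f 2 μ)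
    (hfO : Function.support f ⊆ φ.source) {ΓH : Set H} [Countable ΓH]
    {C : Set (J → ℝ)} (hCm : MeasurableSet C) (hC0 : volume C ≠ 0) (hC : volume C ≠ ⊤)
    (hCO : theta lam b J φ '' φ.target ⊆ C) {ΓN : Set N}
    (hΓNp : ∀ x ∈ ΓN, lieLog (EN := EN) x ∈ Submodule.span ℝ (b '' J))
    (hΓNC : IsOrthonormalBasis fun x : ΓN => expVec b J hC (lieLog (EN := EN) (x : N)))
    (g : Lp ℂ 2 μ) (hfin : ∫⁻ h, ‖g h‖ₑ ^ 2 * orbitSum lam b J φ μ ΓH f h ∂μ ≠ ⊤) :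
    ∑' p : ΓH × ΓN, ‖⟪g, inducedRep hN hH hNH lam μ
        (((p.1 : H) : G)⁻¹ * ((p.2 : N) : G)) (hf2.toLp f)⟫_ℂ‖ₑ ^ 2 =
      volume C * ∫⁻ h, ‖g h‖ₑ ^ 2 * orbitSum lam b J φ μ ΓH f h ∂μ := by
  have : IsTopologicalGroup G := topologicalGroup_of_lieGroup 𝓘(ℝ, EG) ∞
  have hWm : Measurable fun h : H => densityW lam b J φ μ (betaCoord lam b J h) :=
    (Measure.measurable_rnDeriv _ _).comp (continuous_betaCoord lam b J hN hH).measurable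
  have htm : ∀ l : ΓH, AEMeasurable (fun h : H => ‖g h‖ₑ ^ 2 * (‖f ((l : H) * h)‖ₑ ^ 2 *
      densityW lam b J φ μ (betaCoord lam b J ((l : H) * h)))) μ := fun l =>
    ((measurable_enorm_Lp_sq g).mul
      (((hf.enorm.pow_const 2).mul hWm).comp (measurable_const_mul (l : H)))).aemeasurable
  simp only [orbitSum_eq lam b J φ μ hfO ΓH, ← ENNReal.tsum_mul_left] at hfin ⊢
  -- Tonelli over the countable `ΓH`; finiteness of the total then gives it for each `l`.
  rw [lintegral_tsum htm] at hfin ⊢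
  rw [← ENNReal.tsum_mul_left, ENNReal.tsum_prod']
  exact tsum_congr fun l => tsum_enorm_inner_inducedRep_sq hN hH hNH hφ hf hf2 hfO hCm hC0 hC
    hCO hΓNp hΓNC l g (ENNReal.ne_top_of_tsum_ne_top hfin l)

end Main

end HLocalized

/-! ### The frame inequality and its two special cases -/

theorem mainTheorem3
    {EG EN EH : Type*}
    [NormedAddCommGroup EG] [NormedSpace ℝ EG] [FiniteDimensional ℝ EG]
    [NormedAddCommGroup EN] [NormedSpace ℝ EN] [FiniteDimensional ℝ EN]
    [NormedAddCommGroup EH] [NormedSpace ℝ EH] [FiniteDimensional ℝ EH]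
    -- the Lie group `G = NH`
    {G : Type*} [Group G] [TopologicalSpace G] [T2Space G] [SecondCountableTopology G]
    [ChartedSpace EG G] [LieGroup 𝓘(ℝ, EG) ∞ G]
    (N H : Subgroup G) [N.Normal]
    [ChartedSpace EN N] [LieGroup 𝓘(ℝ, EN) ∞ N]
    [ChartedSpace EH H] [LieGroup 𝓘(ℝ, EH) ∞ H] [ConnectedSpace H]
    (hN : HLocalized.IsClosedLieSubgroup EG EN N) (hH : HLocalized.IsClosedLieSubgroup EG EH H)
    (hNH : Subgroup.IsComplement' N H)
    (hexp : HLocalized.IsExponentialSolvable EN N)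
    -- the linear functional `lam`, vanishing on `[𝔫, 𝔫]`
    (lam : Module.Dual ℝ (GroupLieAlgebra 𝓘(ℝ, EN) N))
    (hlam : ∀ X Y : GroupLieAlgebra 𝓘(ℝ, EN) N, lam ⁅X, Y⁆ = 0)
    -- a left Haar measure on `H`
    [MeasurableSpace H] [BorelSpace H] (μ : Measure H) [μ.IsHaarMeasure]
    -- the basis `X_1, …, X_n` of `𝔫`, the index set `J`, the chart `(𝒪, φ)`
    {n : ℕ} (b : Module.Basis (Fin n) ℝ (GroupLieAlgebra 𝓘(ℝ, EN) N)) (J : Finset (Fin n))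
    (φ : OpenPartialHomeomorph H EH) (hφ : HLocalized.IsAdmissibleChart lam b J φ)
    -- the window
    (f : H → ℂ) (hf : Continuous f) (hfc : HasCompactSupport f)
    (hfO : Function.support f ⊆ φ.source)
    -- the set `Γ_H`
    (ΓH : Set H) (hΓH : DiscreteTopology ΓH)
    (hm : 0 < HLocalized.lowerConst lam b J φ μ ΓH f)
    (hM : HLocalized.upperConst lam b J φ μ ΓH f < ⊤)
    -- the sets `C` and `Γ_N`
    (C : Set (J → ℝ)) (hCm : MeasurableSet C) (hC : volume C ≠ ⊤)
    (hCO : HLocalized.theta lam b J φ '' φ.target ⊆ C)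
    (ΓN : Set N) (hΓN : DiscreteTopology ΓN)
    (hΓNp : ∀ x ∈ ΓN, HLocalized.lieLog (EN := EN) x ∈ Submodule.span ℝ (b '' J))
    (hΓNC : HLocalized.IsOrthonormalBasis fun x : ΓN =>
      HLocalized.expVec b J hC (HLocalized.lieLog (EN := EN) (x : N))) :
    let v : ΓH × ΓN → Lp ℂ 2 μ := fun p =>
      HLocalized.inducedRep hN hH hNH lam μ (((p.1 : H) : G)⁻¹ * ((p.2 : N) : G))
        ((hf.memLp_of_hasCompactSupport hfc).toLp f)
    let m := HLocalized.lowerConst lam b J φ μ ΓH f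
    let M := HLocalized.upperConst lam b J φ μ ΓH f
    HLocalized.IsFrameWithBounds v (m * volume C).toReal (M * volume C).toReal ∧
      (m = M → HLocalized.IsTightFrame v) ∧
      (m = M → M = (volume C)⁻¹ → ∫ h, ‖f h‖ ^ 2 ∂μ = 1 → HLocalized.IsOrthonormalBasis v) := by
  intro v m M
  have : IsTopologicalGroup G := topologicalGroup_of_lieGroup 𝓘(ℝ, EG) ∞
  have : SecondCountableTopology H := Topology.IsEmbedding.subtypeVal.secondCountableTopology
  have : LocallyCompactSpace H := Manifold.locallyCompact_of_finiteDimensional 𝓘(ℝ, EH)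
  have : Countable ΓH := TopologicalSpace.separableSpace_iff_countable.1 inferInstance
  have hf2 : MemLp f 2 μ := hf.memLp_of_hasCompactSupport hfc
  -- `C` contains the nonempty open image of `𝒪` in `ℝ^J`.
  have hC0 : volume C ≠ 0 := by
    obtain ⟨e, hes, heT, -, -⟩ := hφ.exists_coord
    have h1 : (1 : H) ∈ e.source := hes ▸ hφ.one_mem
    refine ((e.open_target.measure_pos volume ⟨e 1, e.map_source h1⟩).trans_le
      (measure_mono fun y hy => hCO ?_)).ne'
    have h2 : e.symm y ∈ φ.source := hes ▸ e.map_target hy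
    refine ⟨φ (e.symm y), φ.map_source h2, ?_⟩
    rw [HLocalized.theta_chart lam b J φ h2, heT (e.map_target hy), e.right_inv hy]
  have hmM : m ≤ M := by
    -- A point satisfying both almost-everywhere bounds exists because Haar measure is nonzero.
    obtain ⟨h, h1, h2⟩ := ((ae_essInf_le (μ := μ)
      (f := HLocalized.orbitSum lam b J φ μ ΓH f)).and (ENNReal.ae_le_essSup _)).exists
    exact h1.trans h2
  have hup : ∀ g : Lp ℂ 2 μ,
      ∫⁻ h, ‖g h‖ₑ ^ 2 * HLocalized.orbitSum lam b J φ μ ΓH f h ∂μ ≤ M * ‖g‖ₑ ^ 2 := fun g => by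
    rw [HLocalized.enorm_Lp_two_sq, mul_comm, ← lintegral_mul_const _ (HLocalized.measurable_enorm_Lp_sq g)]
    refine lintegral_mono_ae ?_
    filter_upwards [ENNReal.ae_le_essSup (HLocalized.orbitSum lam b J φ μ ΓH f)] with h hh
    gcongr
    exact hh
  have hlow : ∀ g : Lp ℂ 2 μ, m * ‖g‖ₑ ^ 2 ≤
      ∫⁻ h, ‖g h‖ₑ ^ 2 * HLocalized.orbitSum lam b J φ μ ΓH f h ∂μ := fun g => by
    rw [HLocalized.enorm_Lp_two_sq, mul_comm, ← lintegral_mul_const _ (HLocalized.measurable_enorm_Lp_sq g)]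
    refine lintegral_mono_ae ?_
    filter_upwards [ae_essInf_le (f := HLocalized.orbitSum lam b J φ μ ΓH f) (μ := μ)] with h hh
    gcongr
    exact hh
  have hsum : ∀ g : Lp ℂ 2 μ, ∑' p, ‖⟪g, v p⟫_ℂ‖ₑ ^ 2 =
      volume C * ∫⁻ h, ‖g h‖ₑ ^ 2 * HLocalized.orbitSum lam b J φ μ ΓH f h ∂μ := fun g =>
    HLocalized.tsum_enorm_inner_eq_lintegral_orbitSum hN hH hNH hφ hf.measurable hf2 hfO hCm hC0
      hC hCO hΓNp hΓNC g
      (ne_top_of_le_ne_top (ENNReal.mul_ne_top hM.ne (ENNReal.pow_ne_top enorm_ne_top)) (hup g))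
  have hframe : HLocalized.IsFrameWithBounds v (m * volume C).toReal (M * volume C).toReal := by
    refine HLocalized.IsFrameWithBounds.of_enorm (mul_ne_zero hm.ne' hC0) (by gcongr)
      (ENNReal.mul_ne_top hM.ne hC) (fun g => ?_) (fun g => ?_)
    · rw [hsum, mul_comm m, mul_assoc]
      gcongr
      exact hlow g
    · rw [hsum, mul_comm M, mul_assoc]
      gcongr
      exact hup g
  refine ⟨hframe, fun h => ⟨_, h ▸ hframe⟩, fun h1 h2 h3 => ?_⟩
  -- Both bounds are now `|C|⁻¹|C| = 1`; as `π` is isometric, unit norm of the family reduces to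
  -- `‖f‖ = 1`.
  rw [h1, h2, ENNReal.inv_mul_cancel hC0 hC, ENNReal.toReal_one] at hframe
  refine hframe.isOrthonormalBasis fun p => ?_
  rw [HLocalized.norm_inducedRep]
  have hn : ‖hf2.toLp f‖ ^ 2 = 1 := by
    have h4 : (⟪hf2.toLp f, hf2.toLp f⟫_ℂ).re = ‖hf2.toLp f‖ ^ 2 :=
      inner_self_eq_norm_sq (𝕜 := ℂ) _
    have h5 : ⟪hf2.toLp f, hf2.toLp f⟫_ℂ = ((∫ h, ‖f h‖ ^ 2 ∂μ : ℝ) : ℂ) := by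
      rw [L2.inner_def, ← integral_complex_ofReal]
      refine integral_congr_ae ?_
      filter_upwards [hf2.coeFn_toLp] with h hh
      rw [hh, inner_self_eq_norm_sq_to_K]
      norm_cast
    rw [← h4, h5, h3, Complex.ofReal_re]
  exact (pow_eq_one_iff_of_nonneg (norm_nonneg _) two_ne_zero).1 hn
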